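/- Let $k$ be a positive integer that is not a perfect square, let $d$ be a positive integer, and suppose that $\dfrac{4d^2}{k-d^2}\in\mathbb{Z}$. Let $f(x)=\dfrac{dx+k}{x+d}$, regarded as a transformation of the real projective line $\mathbb{R}\cup\{\infty\}$, and let $\{f^n(\infty)\}_{n\ge 1}=\{f(\infty),f(f(\infty)),\dots\}$ be the forward orbit of $\infty$. Call a continued fraction convergent $p/q$ of $\sqrt{k}$ (in lowest terms, with $p,q>0$) \emph{Pellian} if $p^2-kq^2=\pm1$. Let $F_0=0$, $F_1=1$, $F_{n+1}=F_n+F_{n-1}$ be the Fibonacci numbers and $G_0=0$, $G_1=1$, $G_{n+1}=2G_n+G_{n-1}$ the Pell numbers. Then the orbit $\{f^n(\infty)\}_{n\ge1}$ contains all Pellian convergents of $\sqrt{k}$ if and only if $(k,d)$ is not a pair of one of the following forms, with $s$ a positive integer: \begin{itemize} \item $k=5s^2$ and $d=3s$ or $d=5s$, where $2s\mid F_{2n+1}$ for some integer $n\ge0$; \item $k=2s^2$ and $d=2s$, where $s\mid G_{2n+1}$ for some integer $n\ge0$. \end{itemize} In every case (also for the exceptional pairs) the orbit contains all convergents $p/q$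 of $\sqrt{k}$ with $p^2-kq^2=1$. -/

import Mathlib

open scoped OnePoint

noncomputable section

/-- The linear fractional transformation `x ↦ (d x + k) / (x + d)` of the real projective line
`ℝ ∪ {∞}`, with `∞ ↦ d` and `-d ↦ ∞`. -/
def sqrtLFT (k d : ℝ) : OnePoint ℝ → OnePoint ℝ
  | ∞ => (d : OnePoint ℝ)
  | (x : ℝ) => if x + d = 0 then ∞ else (((d * x + k) / (x + d) : ℝ) : OnePoint ℝ)

/-- The forward orbit `{f(∞), f(f(∞)), …}` of `∞` under `f(x) = (d x + k) / (x + d)`. -/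
def orbitInfty (k d : ℝ) : Set (OnePoint ℝ) :=
  {y | ∃ n : ℕ, 1 ≤ n ∧ (sqrtLFT k d)^[n] ∞ = y}

/-- `p / q`, with `p, q > 0` in lowest terms, is a convergent of the simple continued fraction
of `√k`. -/
def IsSqrtConvergent (k p q : ℤ) : Prop :=
  0 < p ∧ 0 < q ∧ IsCoprime p q ∧
    ∃ n : ℕ, (GenContFract.of (Real.sqrt (k : ℝ))).convs n = (p : ℝ) / (q : ℝ)

/-- `p / q` is a Pellian convergent of `√k`. -/
def IsPellianConvergent (k p q : ℤ) : Prop :=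
  IsSqrtConvergent k p q ∧ (p ^ 2 - k * q ^ 2 = 1 ∨ p ^ 2 - k * q ^ 2 = -1)

/-- The Pell numbers `0, 1, 2, 5, 12, 29, …`. -/
def pellNumber : ℕ → ℕ
  | 0 => 0
  | 1 => 1
  | n + 2 => 2 * pellNumber (n + 1) + pellNumber n

/-- The exceptional pairs `(k, d)`. -/
def IsExceptionalPair (k d : ℤ) : Prop :=
  ∃ s : ℕ, 0 < s ∧
    ((k = 5 * (s : ℤ) ^ 2 ∧ (d = 3 * (s : ℤ) ∨ d = 5 * (s : ℤ)) ∧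
        ∃ n : ℕ, 2 * s ∣ Nat.fib (2 * n + 1)) ∨
      (k = 2 * (s : ℤ) ^ 2 ∧ d = 2 * (s : ℤ) ∧ ∃ n : ℕ, s ∣ pellNumber (2 * n + 1)))

end

/-!
The coordinate `(x - √k) / (x + √k)` conjugates `f` to multiplication by `(d - √k) / (d + √k)`.
The hypothesis on `4d² / (k - d²)` says that the inverse `u` of this multiplier, a number of norm
`1`, is an algebraic integer. Put `τ = sign (d² - k)` and write `4d² / |d² - k| = ab²` with `a`
squarefree and `ab² - c = 4τ`. Then `2d = abt` and `4k = t²ac` for some `t`, and `τu = B²` for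
`B = (b√a + √c) / 2`. If `p + q√k = B ^ n` and `p² - kq² = τ ^ n`, then `p / q = f^n(∞)`.

A unit `w = (X + Y√(ac)) / 2 > 1` of norm `σ` satisfies `w - σ/w = Y√(ac) ≥ √c = B - τ/B`, whence
`w ≥ B` unless `τ = 1` and `σ = -1`; multiplying by powers of `B²` then shows that all such `w` are
powers of `B`. In the remaining case a unit `w` of norm `-1` in `(1, B]` exists only for three
triples `(a, b, c)`, which give the exceptional shapes of `(k, d)`. For these `d² > k`, so the orbit
stays above `√k` and misses the solutions of `p² - kq² = -1`, which lie below it.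

Whether such solutions exist is a divisibility condition on Fibonacci or Pell numbers, by the same
argument for `(a, b, c) = (1, b, b² + 4)` with `b = 1` or `b = 2`, where `B` is the golden or the
silver mean and the powers of `B` are given by these numbers.
-/

section Orbit

variable {k d x : ℝ}

theorem abs_sub_sqrt_lt_add_sqrt (hk : 0 < k) (hd : 0 < d) : |d - √k| < d + √k := by
  have hr : 0 < √k := Real.sqrt_pos.2 hk
  exact abs_lt.2 ⟨by linarith, by linarith⟩

theorem sub_sqrt_pow_lt_add_sqrt_pow (hk : 0 < k) (hd : 0 < d) {n : ℕ} (hn : n ≠ 0) :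
    (d - √k) ^ n < (d + √k) ^ n := by
  refine (le_abs_self _).trans_lt ?_
  rw [abs_pow]
  exact pow_lt_pow_left₀ (abs_sub_sqrt_lt_add_sqrt hk hd) (abs_nonneg _) hn

theorem sqrtLFT_coe (hx : x + d ≠ 0) :
    sqrtLFT k d x = (((d * x + k) / (x + d) : ℝ) : OnePoint ℝ) :=
  if_neg hx

/-- The coordinate `(x - √k) / (x + √k)` conjugates `sqrtLFT k d` to multiplication by
`(d - √k) / (d + √k)`. -/
theorem exists_iterate_sqrtLFT_infty (hk : 0 < k) (hd : 0 < d) {n : ℕ} (hn : 1 ≤ n) :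
    ∃ x : ℝ, 0 < x ∧ (sqrtLFT k d)^[n] ∞ = x ∧
      (x - √k) * (d + √k) ^ n = (x + √k) * (d - √k) ^ n := by
  induction n, hn using Nat.le_induction with
  | base => exact ⟨d, hd, rfl, by ring⟩
  | succ n _ ih =>
    obtain ⟨x, hx, hiter, hconj⟩ := ih
    have hrr : √k ^ 2 = k := Real.sq_sqrt hk.le
    have hxd : x + d ≠ 0 := by positivity
    refine ⟨(d * x + k) / (x + d), by positivity, ?_, ?_⟩
    · rw [Function.iterate_succ_apply', hiter, sqrtLFT_coe hxd]
    · have hsub : (d * x + k) / (x + d) - √k = (d - √k) * (x - √k) / (x + d) := by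
        field_simp
        linear_combination -hrr
      have hadd : (d * x + k) / (x + d) + √k = (d + √k) * (x + √k) / (x + d) := by
        field_simp
        linear_combination -hrr
      rw [hsub, hadd]
      field_simp
      linear_combination (d - √k) * (d + √k) * hconj

theorem coe_mem_orbitInfty_iff (hk : 0 < k) (hd : 0 < d) :
    (x : OnePoint ℝ) ∈ orbitInfty k d ↔
      ∃ n : ℕ, 1 ≤ n ∧ (x - √k) * (d + √k) ^ n = (x + √k) * (d - √k) ^ n := by
  refine exists_congr fun n ↦ and_congr_right fun hn ↦ ?_
  obtain ⟨y, -, hiter, hy⟩ := exists_iterate_sqrtLFT_infty hk hd hn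
  rw [hiter, OnePoint.coe_eq_coe]
  refine ⟨fun h ↦ h ▸ hy, fun hx ↦ ?_⟩
  have hlt := sub_sqrt_pow_lt_add_sqrt_pow hk hd (n := n) (by omega)
  apply mul_right_cancel₀ (sub_pos.2 hlt).ne'
  linear_combination hy - hx

theorem sqrt_lt_of_mem_orbitInfty (hk : 0 < k) (hd : 0 < d) (hkd : k < d ^ 2)
    (hx : (x : OnePoint ℝ) ∈ orbitInfty k d) : √k < x := by
  obtain ⟨n, hn, h⟩ := (coe_mem_orbitInfty_iff hk hd).1 hx
  have : 0 < √k := Real.sqrt_pos.2 hk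
  have hpos : 0 < (d - √k) ^ n := pow_pos (sub_pos.2 ((Real.sqrt_lt' hd).2 hkd)) n
  have hlt := sub_sqrt_pow_lt_add_sqrt_pow hk hd (n := n) (by omega)
  refine lt_of_mul_lt_mul_right ?_ (sub_pos.2 hlt).le
  calc √k * ((d + √k) ^ n - (d - √k) ^ n)
      < √k * ((d + √k) ^ n + (d - √k) ^ n) := by gcongr; linarith
    _ = x * ((d + √k) ^ n - (d - √k) ^ n) := by linear_combination -h

end Orbit

section NegPell

variable {k p q : ℤ}

theorem two_le_of_neg_pell (hp : 0 < p) (h : p ^ 2 - k * q ^ 2 = -1) : 2 ≤ k := by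
  by_contra! hk
  have hle : k * q ^ 2 ≤ q ^ 2 := by nlinarith [sq_nonneg q]
  obtain rfl | hk0 : k = 1 ∨ k ≤ 0 := by omega
  · nlinarith [sq_abs q, abs_nonneg q, show p + 1 ≤ |q| from lt_of_pow_lt_pow_left₀ 2
      (abs_nonneg q) (by rw [sq_abs]; linarith)]
  · nlinarith [mul_nonneg (neg_nonneg.2 hk0) (sq_nonneg q)]

/-- Legendre's criterion: `√k - p/q = 1 / (q (q √k + p))`, and `q √k + p > 2q`. -/
theorem isSqrtConvergent_of_neg_pell (hp : 0 < p) (hq : 0 < q) (h : p ^ 2 - k * q ^ 2 = -1) :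
    IsSqrtConvergent k p q := by
  have hk := two_le_of_neg_pell hp h
  have hcop : IsCoprime p q := ⟨-p, k * q, by linear_combination -h⟩
  have hpq : q ≤ p := by
    by_contra! hlt
    nlinarith
  have hkR : (2 : ℝ) ≤ k := mod_cast hk
  have hqR : (0 : ℝ) < q := mod_cast hq
  have hpR : (q : ℝ) ≤ p := mod_cast hpq
  have hR : (p : ℝ) ^ 2 - k * q ^ 2 = -1 := mod_cast h
  have hr : 1 < √(k : ℝ) := Real.lt_sqrt_of_sq_lt (by linarith)
  have hrr : √(k : ℝ) ^ 2 = k := Real.sq_sqrt (by linarith)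
  have hdist : √(k : ℝ) - p / q = 1 / (q * (q * √(k : ℝ) + p)) := by
    have : q * √(k : ℝ) + p ≠ 0 := by positivity
    field_simp
    linear_combination (q : ℝ) ^ 2 * hrr - hR
  have hden : (((p / q : ℚ).den : ℤ) : ℝ) = q := by
    rw [Rat.den_div_eq_of_coprime hq (Int.isCoprime_iff_nat_coprime.1 hcop)]
  have hclose : |√(k : ℝ) - ((p / q : ℚ) : ℝ)| < 1 / (2 * ((p / q : ℚ).den : ℝ) ^ 2) := by
    rw [← Int.cast_natCast (R := ℝ), hden]
    push_cast
    rw [hdist, abs_of_pos (by positivity)]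
    have hsum : 2 * (q : ℝ) < q * √(k : ℝ) + p := by
      linarith [mul_lt_mul_of_pos_left hr hqR]
    apply one_div_lt_one_div_of_lt (by positivity)
    linarith [mul_lt_mul_of_pos_left hsum hqR]
  obtain ⟨n, hn⟩ := Real.exists_convs_eq_rat hclose
  exact ⟨hp, hq, hcop, n, by rw [hn]; push_cast; rfl⟩

theorem div_lt_sqrt_of_neg_pell (hp : 0 < p) (hq : 0 < q) (h : p ^ 2 - k * q ^ 2 = -1) :
    (p : ℝ) / q < √(k : ℝ) := by
  have hqR : (0 : ℝ) < q := mod_cast hq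
  have hR : (p : ℝ) ^ 2 - k * q ^ 2 = -1 := mod_cast h
  rw [div_lt_iff₀ hqR]
  apply lt_of_pow_lt_pow_left₀ 2 (by positivity)
  rw [mul_pow, Real.sq_sqrt (mod_cast (two_le_of_neg_pell hp h).trans' zero_le_two)]
  linarith

end NegPell

/-- `w` is an integer `(X + Y√D) / 2` of norm `σ` in the quadratic field `ℚ(√D)`. The congruence
`X ≡ D Y (mod 2)`, needed for closure under multiplication, follows from the norm equation. -/
def IsQuadraticInteger (D σ : ℤ) (w : ℝ) : Prop :=
  ∃ X Y : ℤ, X ^ 2 - D * Y ^ 2 = 4 * σ ∧ w = (X + Y * √(D : ℝ)) / 2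

namespace IsQuadraticInteger

variable {D σ τ : ℤ} {w z : ℝ}

theorem even_iff_of_norm {X Y : ℤ} (h : X ^ 2 - D * Y ^ 2 = 4 * σ) :
    Even X ↔ Even D ∨ Even Y := by
  have : Even (X ^ 2 - D * Y ^ 2) := h ▸ ⟨2 * σ, by ring⟩
  simpa [parity_simps] using this

theorem mul (hD : 0 ≤ D) (hw : IsQuadraticInteger D σ w) (hz : IsQuadraticInteger D τ z) :
    IsQuadraticInteger D (σ * τ) (w * z) := by
  obtain ⟨X, Y, hXY, rfl⟩ := hw
  obtain ⟨U, V, hUV, rfl⟩ := hz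
  have hX := even_iff_of_norm hXY
  have hU := even_iff_of_norm hUV
  obtain ⟨S, hS⟩ : Even (X * U + D * (Y * V)) := by simp only [parity_simps]; tauto
  obtain ⟨T, hT⟩ : Even (X * V + Y * U) := by simp only [parity_simps]; tauto
  refine ⟨S, T, ?_, ?_⟩
  · have : 4 * (S ^ 2 - D * T ^ 2) = (X ^ 2 - D * Y ^ 2) * (U ^ 2 - D * V ^ 2) := by
      linear_combination -(X * U + D * (Y * V) + 2 * S) * hS + D * (X * V + Y * U + 2 * T) * hT
    rw [hXY, hUV] at this
    linarith
  · have hrr : √(D : ℝ) ^ 2 = D := Real.sq_sqrt (mod_cast hD)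
    have hSR : (X * U + D * (Y * V) : ℝ) = S + S := mod_cast hS
    have hTR : (X * V + Y * U : ℝ) = T + T := mod_cast hT
    linear_combination hSR / 4 + √(D : ℝ) / 4 * hTR + (Y * V / 4 : ℝ) * hrr

theorem one : IsQuadraticInteger D 1 1 :=
  ⟨2, 0, by ring, by simp⟩

theorem pow (hD : 0 ≤ D) (hw : IsQuadraticInteger D 1 w) (n : ℕ) :
    IsQuadraticInteger D 1 (w ^ n) := by
  induction n with
  | zero => simpa using one
  | succ n ih => simpa [pow_succ] using ih.mul hD hw

theorem conj_mul_self (hD : 0 ≤ D) {X Y : ℤ} (h : X ^ 2 - D * Y ^ 2 = 4 * σ) :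
    (X - Y * √(D : ℝ)) / 2 * ((X + Y * √(D : ℝ)) / 2) = σ := by
  have hrr : √(D : ℝ) ^ 2 = D := Real.sq_sqrt (mod_cast hD)
  have hR : (X : ℝ) ^ 2 - D * Y ^ 2 = 4 * σ := mod_cast h
  linear_combination hR / 4 - (Y ^ 2 / 4 : ℝ) * hrr

/-- Both sides have the same norm, hence the same conjugate. -/
theorem coeff_unique (hD : 0 < D) {X Y U V : ℤ} (h : X ^ 2 - D * Y ^ 2 = 4 * σ)
    (h' : U ^ 2 - D * V ^ 2 = 4 * σ) (hne : (X + Y * √(D : ℝ)) / 2 ≠ 0)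
    (heq : (X + Y * √(D : ℝ)) / 2 = (U + V * √(D : ℝ)) / 2) : Y = V := by
  have hnorm := (conj_mul_self hD.le h).trans (conj_mul_self hD.le h').symm
  rw [← heq] at hnorm
  have hconj := mul_right_cancel₀ hne hnorm
  have hsqrt : √(D : ℝ) ≠ 0 := (Real.sqrt_pos.2 (mod_cast hD)).ne'
  exact_mod_cast mul_right_cancel₀ hsqrt (by linarith : Y * √(D : ℝ) = V * √(D : ℝ))

theorem inv (hD : 0 ≤ D) (hσ : σ ^ 2 = 1) (hw : IsQuadraticInteger D σ w) :
    IsQuadraticInteger D σ w⁻¹ := by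
  obtain ⟨X, Y, h, rfl⟩ := hw
  refine ⟨σ * X, -(σ * Y), by linear_combination σ ^ 2 * h + 4 * σ * hσ, ?_⟩
  have hσR : (σ : ℝ) ^ 2 = 1 := mod_cast hσ
  refine inv_eq_of_mul_eq_one_left ?_
  push_cast
  linear_combination σ * conj_mul_self hD h + hσR

theorem exists_add_div_sub_div (hD : 0 ≤ D) (hw : IsQuadraticInteger D σ w) (hw0 : w ≠ 0) :
    ∃ X Y : ℤ, X ^ 2 - D * Y ^ 2 = 4 * σ ∧ w + σ / w = X ∧ w - σ / w = Y * √(D : ℝ) := by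
  obtain ⟨X, Y, h, rfl⟩ := hw
  have hconj := eq_div_of_mul_eq hw0 (conj_mul_self hD h)
  exact ⟨X, Y, h, by rw [← hconj]; ring, by rw [← hconj]; ring⟩

theorem norm_eq_one (hD : 4 < D) (hσ : σ ^ 2 = 1) (h : IsQuadraticInteger D σ 1) : σ = 1 := by
  obtain ⟨X, Y, hXY, hX, -⟩ := h.exists_add_div_sub_div (by omega) one_ne_zero
  have hX : 1 + σ = X := by exact_mod_cast (div_one (σ : ℝ)) ▸ hX
  rcases sq_eq_one_iff.1 hσ with rfl | rfl
  · rfl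
  · obtain rfl : X = 0 := by omega
    rcases eq_or_ne Y 0 with rfl | hY
    · omega
    · have : 0 < Y ^ 2 := by positivity
      nlinarith

theorem sqrt_le_sub_div (hD : 0 ≤ D) (hσ : σ ^ 2 = 1) (hw : IsQuadraticInteger D σ w)
    (hw1 : 1 < w) : √(D : ℝ) ≤ w - σ / w := by
  obtain ⟨X, Y, -, -, hY⟩ := hw.exists_add_div_sub_div hD (by positivity)
  have hσ1 : (σ : ℝ) ≤ 1 := by
    rcases sq_eq_one_iff.1 hσ with rfl | rfl <;> norm_num
  have hpos : 0 < w - σ / w := by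
    rw [sub_pos, div_lt_iff₀ (by positivity)]
    nlinarith
  have hY0 : (0 : ℝ) < Y := pos_of_mul_pos_left (hY ▸ hpos) (Real.sqrt_nonneg _)
  have hY1 : (1 : ℝ) ≤ Y := mod_cast hY0
  rw [hY]
  exact le_mul_of_one_le_left (Real.sqrt_nonneg _) hY1

/-- Multiply `ε^{±1}` by an even power of `B`, keeping the norm, to bring it into `[1, B]`. -/
theorem exists_eq_pow (hD : 0 ≤ D) (hσ : σ ^ 2 = 1) {B ε : ℝ} (hB : 1 < B)
    (hB2 : IsQuadraticInteger D 1 (B ^ 2))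
    (hmin : ∀ w, IsQuadraticInteger D σ w → 1 < w → B ≤ w)
    (hε : IsQuadraticInteger D σ ε) (hε1 : 1 ≤ ε) :
    ∃ n : ℕ, ε = B ^ n ∧
      (Even n ∧ IsQuadraticInteger D σ 1 ∨ Odd n ∧ IsQuadraticInteger D σ B) := by
  obtain ⟨n, hle, hlt⟩ := exists_nat_pow_near hε1 hB
  have hpow : 0 < B ^ n := by positivity
  have hε0 : 0 < ε := by positivity
  refine ⟨n, ?_⟩
  rcases n.even_or_odd' with ⟨m, rfl | rfl⟩
  · have hw : IsQuadraticInteger D σ (ε / B ^ (2 * m)) := by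
      simpa [div_eq_mul_inv, pow_mul] using hε.mul hD ((hB2.pow hD m).inv hD (one_pow 2))
    have hw1 : ε / B ^ (2 * m) = 1 := by
      by_contra hne
      have hBw := hmin _ hw (lt_of_le_of_ne ((one_le_div hpow).2 hle) (Ne.symm hne))
      rw [le_div_iff₀ hpow, ← pow_succ'] at hBw
      exact hBw.not_gt hlt
    exact ⟨(div_eq_one_iff_eq hpow.ne').1 hw1, Or.inl ⟨even_two_mul m, hw1 ▸ hw⟩⟩
  · have hw : IsQuadraticInteger D σ (B ^ (2 * m + 1 + 1) / ε) := by
      have := (hB2.pow hD (m + 1)).mul hD (hε.inv hD hσ)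
      rwa [one_mul, ← pow_mul, ← div_eq_mul_inv] at this
    have hBw := hmin _ hw ((one_lt_div hε0).2 hlt)
    rw [le_div_iff₀ hε0, pow_succ', mul_le_mul_iff_right₀ (by positivity)] at hBw
    obtain rfl := le_antisymm hBw hle
    rw [pow_succ', mul_div_assoc, div_self hε0.ne', mul_one] at hw
    exact ⟨rfl, Or.inr ⟨odd_two_mul_add_one m, hw⟩⟩

end IsQuadraticInteger

theorem strictMonoOn_sub_div {σ : ℝ} (hσ : -1 ≤ σ) :
    StrictMonoOn (fun x : ℝ ↦ x - σ / x) (Set.Ici 1) := by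
  intro x hx y _ hxy
  have hx1 : 1 ≤ x := hx
  have hx0 : 0 < x := by positivity
  have hy0 : 0 < y := hx0.trans hxy
  have hfactor : y - σ / y - (x - σ / x) = (y - x) * (x * y + σ) / (x * y) := by
    field_simp
    ring
  have hpos : 0 < (y - x) * (x * y + σ) / (x * y) :=
    div_pos (mul_pos (sub_pos.2 hxy) (by nlinarith)) (by positivity)
  exact sub_pos.1 (hfactor ▸ hpos)

/-- The conditions under which `(b√a + √c) / 2` is the square root of a unit
`(ab² + c + 2b√(ac)) / 4` of norm `1` in `ℚ(√(ac))`; the sign `τ` is the product of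
`(b√a + √c) / 2` and `(b√a - √c) / 2`. -/
structure IsUnitRootData (a b c τ : ℤ) : Prop where
  a_pos : 0 < a
  b_pos : 0 < b
  c_pos : 0 < c
  sign : τ ^ 2 = 1
  norm : a * b ^ 2 - c = 4 * τ

/-- The square root `(b√a + √c) / 2` of a quadratic unit, for parameters satisfying
`IsUnitRootData`. -/
noncomputable def unitRoot (a b c : ℤ) : ℝ :=
  (b * √(a : ℝ) + √(c : ℝ)) / 2

/-- The parameters `(a, b, c)` for which some `(X + Y√(ac)) / 2` of norm `-1` lies in
`(1, unitRoot a b c]` although the parameters have sign `1`. -/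
def exceptionalTriples : Set (ℤ × ℤ × ℤ) :=
  {(5, 1, 1), (1, 3, 5), (2, 2, 4)}

theorem mem_exceptionalTriples_of_le {a b c X Y : ℤ} (ha : 0 < a) (hb : 0 < b) (hc : 0 < c)
    (h : a * b ^ 2 - c = 4) (hX : 0 < X) (hY : 0 < Y) (hXY : X ^ 2 + 4 = a * c * Y ^ 2)
    (hle : c * Y ^ 2 ≤ b ^ 2) : (a, b, c) ∈ exceptionalTriples := by
  obtain rfl : Y = 1 := by
    by_contra hne
    have hY4 : 4 ≤ Y ^ 2 := by nlinarith [show 2 ≤ Y by omega]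
    have h4c : 4 * c ≤ b ^ 2 := by nlinarith
    have hb2 : b ≤ 2 := by nlinarith
    interval_cases b <;> omega
  obtain rfl : c = a * b ^ 2 - 4 := by omega
  have ha5 : a ≤ 5 := by nlinarith
  rcases (show 1 ≤ a from ha).eq_or_lt' with rfl | ha2
  · have hfactor : (b - X) * (b + X) = 8 := by linear_combination -hXY
    have hXb : X < b := by nlinarith
    have hX3 : X ≤ 3 := by nlinarith
    have hb4 : b ≤ 4 := by nlinarith
    interval_cases X <;> interval_cases b <;> simp [exceptionalTriples] at hfactor ⊢
  · have hb2 : b ≤ 2 := by nlinarith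
    interval_cases a <;> interval_cases b <;> simp [exceptionalTriples] at hc hle ⊢

namespace IsUnitRootData

variable {a b c τ σ : ℤ} {w : ℝ}

theorem four_lt_mul (h : IsUnitRootData a b c τ) : 4 < a * c := by
  obtain ⟨ha, hb, hc, hτ, hn⟩ := h
  by_contra! hle
  have ha4 : a ≤ 4 := by nlinarith
  have hc4 : c ≤ 4 := by nlinarith
  have hτ1 : τ ≤ 1 := by nlinarith
  have hb3 : b < 3 := by nlinarith
  rcases sq_eq_one_iff.1 hτ with rfl | rfl <;>
    interval_cases b <;> interval_cases a <;> omega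

theorem disc_nonneg (h : IsUnitRootData a b c τ) : 0 ≤ a * c := by
  linarith [h.four_lt_mul]

theorem sqrt_disc (h : IsUnitRootData a b c τ) :
    √((a * c : ℤ) : ℝ) = √(a : ℝ) * √(c : ℝ) := by
  rw [Int.cast_mul, Real.sqrt_mul (mod_cast h.a_pos.le)]

theorem unitRoot_pos (h : IsUnitRootData a b c τ) : 0 < unitRoot a b c := by
  have ha : (0 : ℝ) < a := mod_cast h.a_pos
  have hb : (0 : ℝ) < b := mod_cast h.b_pos
  unfold unitRoot
  positivity

theorem div_unitRoot (h : IsUnitRootData a b c τ) :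
    τ / unitRoot a b c = (b * √(a : ℝ) - √(c : ℝ)) / 2 := by
  have hsa : √(a : ℝ) ^ 2 = a := Real.sq_sqrt (mod_cast h.a_pos.le)
  have hsc : √(c : ℝ) ^ 2 = c := Real.sq_sqrt (mod_cast h.c_pos.le)
  have hn : (a : ℝ) * b ^ 2 - c = 4 * τ := mod_cast h.norm
  rw [div_eq_iff h.unitRoot_pos.ne', unitRoot]
  linear_combination hsc / 4 - (b ^ 2 / 4 : ℝ) * hsa - hn / 4

theorem unitRoot_add_div (h : IsUnitRootData a b c τ) :
    unitRoot a b c + τ / unitRoot a b c = b * √(a : ℝ) := by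
  rw [h.div_unitRoot, unitRoot]
  ring

theorem unitRoot_sub_div (h : IsUnitRootData a b c τ) :
    unitRoot a b c - τ / unitRoot a b c = √(c : ℝ) := by
  rw [h.div_unitRoot, unitRoot]
  ring

theorem one_lt_unitRoot (h : IsUnitRootData a b c τ) : 1 < unitRoot a b c := by
  have hB := h.unitRoot_pos
  have ha : (0 : ℝ) < a := mod_cast h.a_pos
  have hb : (0 : ℝ) < b := mod_cast h.b_pos
  have hc : (0 : ℝ) < c := mod_cast h.c_pos
  have hlt : 1 / unitRoot a b c < unitRoot a b c := by
    have hadd := h.unitRoot_add_div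
    have hsub := h.unitRoot_sub_div
    have hsa : 0 < b * √(a : ℝ) := by positivity
    have hsc : 0 < √(c : ℝ) := by positivity
    rcases sq_eq_one_iff.1 h.sign with rfl | rfl
    · push_cast at hsub
      linarith
    · push_cast [neg_div] at hadd
      linarith
  rw [div_lt_iff₀ hB] at hlt
  nlinarith

theorem isQuadraticInteger_unitRoot_sq (h : IsUnitRootData a b c τ) :
    IsQuadraticInteger (a * c) 1 (unitRoot a b c ^ 2) := by
  refine ⟨a * b ^ 2 - 2 * τ, b, by linear_combination a * b ^ 2 * h.norm + 4 * h.sign, ?_⟩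
  have hsa : √(a : ℝ) ^ 2 = a := Real.sq_sqrt (mod_cast h.a_pos.le)
  have hsc : √(c : ℝ) ^ 2 = c := Real.sq_sqrt (mod_cast h.c_pos.le)
  have hn : (a : ℝ) * b ^ 2 - c = 4 * τ := mod_cast h.norm
  rw [h.sqrt_disc, unitRoot]
  push_cast
  linear_combination (b ^ 2 / 4 : ℝ) * hsa + hsc / 4 - hn / 4

/-- `w - σ/w ≥ √(ac) ≥ √c = B - τ/B ≥ B - σ/B` for `B = unitRoot a b c`, and `x ↦ x - σ/x` is
increasing. -/
theorem unitRoot_le_of_sign_le (h : IsUnitRootData a b c τ) (hσ : σ ^ 2 = 1) (hτσ : τ ≤ σ)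
    (hw : IsQuadraticInteger (a * c) σ w) (hw1 : 1 < w) :
    unitRoot a b c ≤ w ∧ (w = unitRoot a b c → σ = τ) := by
  have hB := h.unitRoot_pos
  have hac : √(c : ℝ) ≤ √((a * c : ℤ) : ℝ) :=
    Real.sqrt_le_sqrt (mod_cast le_mul_of_one_le_left h.c_pos.le h.a_pos)
  have hle : unitRoot a b c - τ / unitRoot a b c ≤ w - σ / w :=
    h.unitRoot_sub_div ▸ hac.trans (hw.sqrt_le_sub_div h.disc_nonneg hσ hw1)
  constructor
  · have hτσR : (τ : ℝ) ≤ σ := mod_cast hτσ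
    have hσ1 : (-1 : ℝ) ≤ σ := by rcases sq_eq_one_iff.1 hσ with rfl | rfl <;> norm_num
    refine ((strictMonoOn_sub_div hσ1).le_iff_le h.one_lt_unitRoot.le hw1.le).1 (hle.trans' ?_)
    gcongr
  · rintro rfl
    have hστ : (σ : ℝ) ≤ τ := (div_le_div_iff_of_pos_right hB).1 (by linarith)
    exact le_antisymm (mod_cast hστ) hτσ

theorem mem_exceptionalTriples_of_lt (h : IsUnitRootData a b c 1)
    (hw : IsQuadraticInteger (a * c) (-1) w) (hw1 : 1 < w) (hwB : w ≤ unitRoot a b c) :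
    (a, b, c) ∈ exceptionalTriples := by
  obtain ⟨X, Y, hXY, hX, hY⟩ := hw.exists_add_div_sub_div h.disc_nonneg (by positivity)
  have ha : (0 : ℝ) < a := mod_cast h.a_pos
  have hsa : √(a : ℝ) ^ 2 = a := Real.sq_sqrt ha.le
  have hD : √((a * c : ℤ) : ℝ) ^ 2 = a * c := by
    rw [Real.sq_sqrt (mod_cast h.disc_nonneg), Int.cast_mul]
  have hX0 : (0 : ℝ) < X := by
    rw [← hX, Int.cast_neg, Int.cast_one, neg_div, ← sub_eq_add_neg, sub_pos,
      div_lt_iff₀ (by positivity)]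
    nlinarith
  have hpos : 0 < w - (-1 : ℤ) / w := by
    rw [Int.cast_neg, Int.cast_one, neg_div, sub_neg_eq_add]
    positivity
  have hle : Y * √((a * c : ℤ) : ℝ) ≤ b * √(a : ℝ) := by
    rw [← hY, ← h.unitRoot_add_div]
    have := (strictMonoOn_sub_div le_rfl).monotoneOn hw1.le h.one_lt_unitRoot.le hwB
    simpa [neg_div] using this
  have hY0 : (0 : ℝ) < Y := pos_of_mul_pos_left (hY ▸ hpos) (Real.sqrt_nonneg _)
  have hcY : (c : ℝ) * Y ^ 2 ≤ b ^ 2 := by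
    have := pow_le_pow_left₀ (hY ▸ hpos.le) hle 2
    rw [mul_pow, mul_pow, hD, hsa] at this
    exact le_of_mul_le_mul_left (by linarith) ha
  exact mem_exceptionalTriples_of_le h.a_pos h.b_pos h.c_pos (by linarith [h.norm])
    (mod_cast hX0) (mod_cast hY0) (by linarith) (mod_cast hcY)

theorem exists_eq_unitRoot_pow (h : IsUnitRootData a b c τ) (hσ : σ ^ 2 = 1)
    (hexc : ¬ (τ = 1 ∧ σ = -1 ∧ (a, b, c) ∈ exceptionalTriples)) {ε : ℝ}
    (hε : IsQuadraticInteger (a * c) σ ε) (hε1 : 1 ≤ ε) :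
    ∃ n : ℕ, ε = unitRoot a b c ^ n ∧ σ = τ ^ n := by
  have hmin : ∀ w, IsQuadraticInteger (a * c) σ w → 1 < w →
      unitRoot a b c ≤ w ∧ (w = unitRoot a b c → σ = τ) := by
    intro w hw hw1
    by_cases hτσ : τ ≤ σ
    · exact h.unitRoot_le_of_sign_le hσ hτσ hw hw1
    · obtain ⟨rfl, rfl⟩ : τ = 1 ∧ σ = -1 := by
        rcases sq_eq_one_iff.1 hσ with rfl | rfl <;>
          rcases sq_eq_one_iff.1 h.sign with rfl | rfl <;> omega
      have hlt : unitRoot a b c < w := by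
        by_contra! hle
        exact hexc ⟨rfl, rfl, h.mem_exceptionalTriples_of_lt hw hw1 hle⟩
      exact ⟨hlt.le, fun heq ↦ absurd heq hlt.ne'⟩
  obtain ⟨n, hn, ⟨heven, hone⟩ | ⟨hodd, hroot⟩⟩ :=
    IsQuadraticInteger.exists_eq_pow h.disc_nonneg hσ h.one_lt_unitRoot
      h.isQuadraticInteger_unitRoot_sq (fun w hw hw1 ↦ (hmin w hw hw1).1) hε hε1
  · refine ⟨n, hn, ?_⟩
    rw [IsQuadraticInteger.norm_eq_one h.four_lt_mul hσ hone]
    rcases sq_eq_one_iff.1 h.sign with rfl | rfl <;> simp [heven]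
  · refine ⟨n, hn, ?_⟩
    rw [(hmin _ hroot h.one_lt_unitRoot).2 rfl]
    rcases sq_eq_one_iff.1 h.sign with rfl | rfl <;> simp [hodd]

end IsUnitRootData

theorem two_mul_sqrt_eq {k D t : ℤ} (ht : 0 ≤ t) (hD : 4 * k = t ^ 2 * D) :
    2 * √(k : ℝ) = t * √(D : ℝ) := by
  have hDR : 2 ^ 2 * (k : ℝ) = t ^ 2 * D := by
    norm_num
    exact_mod_cast hD
  have hsqrt := congrArg Real.sqrt hDR
  rwa [Real.sqrt_mul (by positivity), Real.sqrt_mul (by positivity), Real.sqrt_sq zero_le_two,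
    Real.sqrt_sq (mod_cast ht)] at hsqrt

theorem isQuadraticInteger_add_mul_sqrt {k D t p q σ : ℤ} (ht : 0 ≤ t)
    (hD : 4 * k = t ^ 2 * D) (h : p ^ 2 - k * q ^ 2 = σ) :
    IsQuadraticInteger D σ (p + q * √(k : ℝ)) := by
  refine ⟨2 * p, t * q, by linear_combination 4 * h + q ^ 2 * hD, ?_⟩
  push_cast
  linear_combination (q / 2 : ℝ) * two_mul_sqrt_eq ht hD

theorem exists_eq_mul_sq_of_mul_eq_sq {M A n : ℤ} (hM : 0 < M) (hn : 0 < n) (h : M * A = n ^ 2) :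
    ∃ a b t : ℤ, 0 < a ∧ 0 < b ∧ 0 < t ∧ n = a * b * t ∧ M = a * t ^ 2 := by
  have hA : 0 < A := pos_of_mul_pos_right (h ▸ by positivity) hM.le
  lift A to ℕ using hA.le
  obtain ⟨a, b, hab, ha⟩ := Nat.sq_mul_squarefree A
  have hab' : (b : ℤ) ^ 2 * a = A := mod_cast hab
  have ha0 : 0 < (a : ℤ) := mod_cast Nat.pos_of_ne_zero ha.ne_zero
  have hb0 : 0 < (b : ℤ) := by
    refine mod_cast Nat.pos_of_ne_zero ?_
    rintro rfl
    simp [← hab'] at hA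
  obtain ⟨e, rfl⟩ : (b : ℤ) ∣ n :=
    (Int.pow_dvd_pow_iff two_ne_zero).1 ⟨M * a, by rw [← h, ← hab']; ring⟩
  have hMe : M * a = e ^ 2 := by
    apply mul_left_cancel₀ (pow_ne_zero 2 hb0.ne')
    linear_combination M * hab' + h
  obtain ⟨t, rfl⟩ : (a : ℤ) ∣ e :=
    ((Int.squarefree_natCast.2 ha).dvd_pow_iff_dvd two_ne_zero).1 ⟨M, by rw [← hMe, mul_comm]⟩
  have ht0 : 0 < t := pos_of_mul_pos_right (pos_of_mul_pos_right hn hb0.le) ha0.le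
  refine ⟨a, b, t, ha0, hb0, ht0, by ring, ?_⟩
  apply mul_left_cancel₀ ha0.ne'
  linear_combination hMe

theorem exists_isUnitRootData {k d : ℤ} (hk : 0 < k) (hd : 0 < d) (hne : k ≠ d ^ 2)
    (hdvd : k - d ^ 2 ∣ 4 * d ^ 2) :
    ∃ a b c t τ : ℤ, IsUnitRootData a b c τ ∧ 0 < t ∧ 2 * d = a * b * t ∧
      4 * k = t ^ 2 * (a * c) := by
  obtain ⟨τ, M, hτ, hM, hτM⟩ : ∃ τ M : ℤ, τ ^ 2 = 1 ∧ 0 < M ∧ d ^ 2 - k = τ * M := by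
    rcases hne.lt_or_gt with h | h
    · exact ⟨1, d ^ 2 - k, one_pow 2, by omega, by ring⟩
    · exact ⟨-1, k - d ^ 2, by norm_num, by omega, by ring⟩
  obtain ⟨R, hR⟩ := hdvd
  obtain ⟨a, b, t, ha, hb, ht, hd2, hMt⟩ := exists_eq_mul_sq_of_mul_eq_sq hM
    (show 0 < 2 * d by positivity) (A := -(τ * R)) (by linear_combination -hR + R * hτM)
  have hk4 : 4 * k = t ^ 2 * (a * (a * b ^ 2 - 4 * τ)) := by
    linear_combination -4 * hτM + (2 * d + a * b * t) * hd2 - 4 * τ * hMt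
  have hc : 0 < a * b ^ 2 - 4 * τ := by
    have : 0 < t ^ 2 * a * (a * b ^ 2 - 4 * τ) := by linarith
    exact pos_of_mul_pos_right this (by positivity)
  exact ⟨a, b, a * b ^ 2 - 4 * τ, t, τ, ⟨ha, hb, hc, hτ, by ring⟩, ht, hd2, hk4⟩

/-- The pairs `(5s², 3s)`, `(5s², 5s)` and `(2s², 2s)`. -/
def IsExceptionalShape (k d : ℤ) : Prop :=
  ∃ s : ℤ, 0 < s ∧ (k = 5 * s ^ 2 ∧ (d = 3 * s ∨ d = 5 * s) ∨ k = 2 * s ^ 2 ∧ d = 2 * s)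

theorem isExceptionalShape_of_mem_exceptionalTriples {k d a b c t : ℤ} (ht : 0 < t)
    (hd : 2 * d = a * b * t) (hk : 4 * k = t ^ 2 * (a * c))
    (h : (a, b, c) ∈ exceptionalTriples) : IsExceptionalShape k d := by
  simp only [exceptionalTriples, Set.mem_insert_iff, Set.mem_singleton_iff, Prod.mk.injEq] at h
  rcases h with ⟨rfl, rfl, rfl⟩ | ⟨rfl, rfl, rfl⟩ | ⟨rfl, rfl, rfl⟩
  · obtain ⟨s, rfl⟩ : 2 ∣ t := by omega
    exact ⟨s, by omega, Or.inl ⟨by linarith, Or.inr (by linarith)⟩⟩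
  · obtain ⟨s, rfl⟩ : 2 ∣ t := by omega
    exact ⟨s, by omega, Or.inl ⟨by linarith, Or.inl (by linarith)⟩⟩
  · exact ⟨t, ht, Or.inr ⟨by linarith, by linarith⟩⟩

theorem IsUnitRootData.add_sqrt_eq_and_sub_sqrt_eq {a b c τ k d t : ℤ}
    (h : IsUnitRootData a b c τ) (ht : 0 ≤ t) (hd : 2 * d = a * b * t)
    (hk : 4 * k = t ^ 2 * (a * c)) :
    d + √(k : ℝ) = t * √(a : ℝ) * unitRoot a b c ∧
      d - √(k : ℝ) = t * √(a : ℝ) * (τ / unitRoot a b c) := by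
  have hsa : √(a : ℝ) ^ 2 = a := Real.sq_sqrt (mod_cast h.a_pos.le)
  have hroot : 2 * √(k : ℝ) = t * (√(a : ℝ) * √(c : ℝ)) :=
    h.sqrt_disc ▸ two_mul_sqrt_eq ht hk
  have hdR : 2 * (d : ℝ) = a * b * t := mod_cast hd
  rw [h.div_unitRoot, unitRoot]
  constructor
  · linear_combination hdR / 2 + hroot / 2 - (b * t / 2 : ℝ) * hsa
  · linear_combination hdR / 2 - hroot / 2 - (b * t / 2 : ℝ) * hsa

theorem one_lt_add_mul_sqrt {k p q : ℤ} (hk : 0 < k) (hp : 0 < p) (hq : 0 < q) :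
    1 < p + q * √(k : ℝ) := by
  have hpR : (1 : ℝ) ≤ p := mod_cast hp
  have : 0 < q * √(k : ℝ) :=
    mul_pos (mod_cast hq) (Real.sqrt_pos.2 (mod_cast hk))
  linarith

theorem div_mem_orbitInfty_or_isExceptionalShape {k d p q σ : ℤ} (hk : 0 < k) (hd : 0 < d)
    (hne : k ≠ d ^ 2) (hdvd : k - d ^ 2 ∣ 4 * d ^ 2) (hσ : σ ^ 2 = 1) (hp : 0 < p) (hq : 0 < q)
    (hpq : p ^ 2 - k * q ^ 2 = σ) :
    (((p : ℝ) / (q : ℝ) : ℝ) : OnePoint ℝ) ∈ orbitInfty (k : ℝ) (d : ℝ) ∨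
      σ = -1 ∧ IsExceptionalShape k d := by
  obtain ⟨a, b, c, t, τ, h, ht, hd2, hk4⟩ := exists_isUnitRootData hk hd hne hdvd
  refine or_iff_not_imp_right.2 fun hexc ↦ ?_
  have hε := isQuadraticInteger_add_mul_sqrt ht.le hk4 hpq
  have hε1 := one_lt_add_mul_sqrt hk hp hq
  obtain ⟨n, hn, rfl⟩ := h.exists_eq_unitRoot_pow hσ (fun ⟨_, hσ1, hmem⟩ ↦ hexc
    ⟨hσ1, isExceptionalShape_of_mem_exceptionalTriples ht hd2 hk4 hmem⟩) hε hε1.le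
  have hn1 : 1 ≤ n := by
    refine Nat.one_le_iff_ne_zero.2 ?_
    rintro rfl
    exact hε1.ne' (by simpa using hn)
  have hconj : p - q * √(k : ℝ) = (τ / unitRoot a b c) ^ n := by
    have hrr : √(k : ℝ) ^ 2 = k := Real.sq_sqrt (mod_cast hk.le)
    have hpqR : (p : ℝ) ^ 2 - k * q ^ 2 = τ ^ n := mod_cast hpq
    rw [div_pow, ← hn, eq_div_iff (by positivity)]
    linear_combination hpqR - (q : ℝ) ^ 2 * hrr
  obtain ⟨hadd, hsub⟩ := h.add_sqrt_eq_and_sub_sqrt_eq ht.le hd2 hk4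
  have hqR : (q : ℝ) ≠ 0 := mod_cast hq.ne'
  refine (coe_mem_orbitInfty_iff (mod_cast hk) (mod_cast hd)).2 ⟨n, hn1, ?_⟩
  rw [hadd, hsub, mul_pow _ (unitRoot a b c), mul_pow _ (τ / unitRoot a b c), ← hn, ← hconj]
  field_simp

/-- The Lucas sequence `Uₙ(b, -1)`: the Fibonacci numbers for `b = 1`, the Pell numbers for
`b = 2`. -/
def lucasSeq (b : ℕ) : ℕ → ℕ
  | 0 => 0
  | 1 => 1
  | n + 2 => b * lucasSeq b (n + 1) + lucasSeq b n

theorem lucasSeq_one (n : ℕ) : lucasSeq 1 n = Nat.fib n := by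
  induction n using Nat.twoStepInduction with
  | zero => rfl
  | one => rfl
  | more n ih ih' => rw [lucasSeq, ih, ih', Nat.fib_add_two, one_mul, add_comm]

theorem lucasSeq_two (n : ℕ) : lucasSeq 2 n = pellNumber n := by
  induction n using Nat.twoStepInduction with
  | zero => rfl
  | one => rfl
  | more n ih ih' => rw [lucasSeq, ih, ih', pellNumber]

theorem lucasSeq_norm (b n : ℕ) :
    (2 * lucasSeq b (n + 1) - b * lucasSeq b n : ℤ) ^ 2 - (b ^ 2 + 4) * lucasSeq b n ^ 2 =
      4 * (-1) ^ n := by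
  induction n with
  | zero => simp [lucasSeq]
  | succ n ih =>
    rw [lucasSeq]
    push_cast
    linear_combination -ih

theorem isUnitRootData_lucas {b : ℕ} (hb : 0 < b) : IsUnitRootData 1 b (b ^ 2 + 4) (-1) where
  a_pos := one_pos
  b_pos := mod_cast hb
  c_pos := by positivity
  sign := by norm_num
  norm := by ring

theorem unitRoot_pow_eq_lucasSeq (b n : ℕ) :
    unitRoot 1 b (b ^ 2 + 4) ^ n = ((2 * lucasSeq b (n + 1) - b * lucasSeq b n : ℝ) +
      lucasSeq b n * √((b ^ 2 + 4 : ℤ) : ℝ)) / 2 := by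
  have hrr : √((b ^ 2 + 4 : ℤ) : ℝ) ^ 2 = b ^ 2 + 4 := by
    rw [Real.sq_sqrt (by positivity)]
    push_cast
    rfl
  induction n with
  | zero => simp [lucasSeq]
  | succ n ih =>
    rw [pow_succ, ih, lucasSeq, unitRoot, Int.cast_one, Real.sqrt_one]
    push_cast at hrr ⊢
    linear_combination (lucasSeq b n / 4 : ℝ) * hrr

theorem exists_eq_lucasSeq {b : ℕ} (hb : 0 < b) {x y : ℤ} (hx : 0 < x) (hy : 0 < y)
    (h : x ^ 2 - (b ^ 2 + 4) * y ^ 2 = -4) : ∃ n : ℕ, y = lucasSeq b (2 * n + 1) := by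
  have hD : 1 < √((b ^ 2 + 4 : ℤ) : ℝ) := Real.lt_sqrt_of_sq_lt (by push_cast; nlinarith)
  have hxR : (1 : ℝ) ≤ x := mod_cast hx
  have hyR : (1 : ℝ) ≤ y := mod_cast hy
  have hw1 : 1 < (x + y * √((b ^ 2 + 4 : ℤ) : ℝ)) / 2 := by nlinarith
  obtain ⟨n, hwn, hn⟩ := (isUnitRootData_lucas hb).exists_eq_unitRoot_pow (σ := -1) (by norm_num)
    (by norm_num) ⟨x, y, by linear_combination h, by rw [one_mul]⟩ hw1.le
  obtain ⟨m, rfl⟩ : Odd n := by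
    by_contra heven
    rw [(Nat.not_odd_iff_even.1 heven).neg_one_pow] at hn
    norm_num at hn
  rw [unitRoot_pow_eq_lucasSeq] at hwn
  refine ⟨m, IsQuadraticInteger.coeff_unique (D := b ^ 2 + 4) (σ := -1) (by positivity)
    (by linear_combination h) ((lucasSeq_norm b _).trans (congrArg (4 * ·) hn.symm))
    (zero_lt_one.trans hw1).ne' ?_⟩
  rw [hwn]
  push_cast
  rfl

theorem exists_neg_pell_iff_dvd_lucasSeq {k : ℤ} {b m : ℕ} (hb : 0 < b) (hm : 0 < m)
    (hk : 4 * k = (b ^ 2 + 4) * m ^ 2) :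
    (∃ p q : ℤ, 0 < p ∧ 0 < q ∧ p ^ 2 - k * q ^ 2 = -1) ↔
      ∃ n : ℕ, m ∣ lucasSeq b (2 * n + 1) := by
  constructor
  · rintro ⟨p, q, hp, hq, h⟩
    obtain ⟨n, hn⟩ := exists_eq_lucasSeq hb (x := 2 * p) (y := m * q) (by positivity)
      (by positivity) (by linear_combination 4 * h + q ^ 2 * hk)
    exact ⟨n, Int.natCast_dvd_natCast.1 ⟨q, hn.symm⟩⟩
  · rintro ⟨n, q, hq⟩
    have hnorm := lucasSeq_norm b (2 * n + 1)
    rw [hq, Odd.neg_one_pow (odd_two_mul_add_one n)] at hnorm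
    push_cast at hnorm
    generalize (2 * lucasSeq b (2 * n + 1 + 1) - b * (m * q) : ℤ) = V at hnorm
    have hV : V ^ 2 = 4 * (k * q ^ 2 - 1) := by linear_combination hnorm - q ^ 2 * hk
    obtain ⟨p, rfl⟩ : 2 ∣ V := (Int.pow_dvd_pow_iff two_ne_zero).1 ⟨k * q ^ 2 - 1, by linarith⟩
    have hpq : p ^ 2 - k * q ^ 2 = -1 := by linarith
    have hq0 : q ≠ 0 := by
      rintro rfl
      norm_num at hpq
      nlinarith
    have hp0 : p ≠ 0 := by
      rintro rfl
      have hmq : (0 : ℤ) < (m * q) ^ 2 := by positivity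
      nlinarith [sq_nonneg (b : ℤ)]
    exact ⟨|p|, q, abs_pos.2 hp0, by positivity, by rwa [sq_abs]⟩

theorem isExceptionalPair_iff {k d : ℤ} : IsExceptionalPair k d ↔
    IsExceptionalShape k d ∧ ∃ p q : ℤ, 0 < p ∧ 0 < q ∧ p ^ 2 - k * q ^ 2 = -1 := by
  have hfive : ∀ {s : ℕ}, 0 < s → k = 5 * (s : ℤ) ^ 2 →
      ((∃ p q : ℤ, 0 < p ∧ 0 < q ∧ p ^ 2 - k * q ^ 2 = -1) ↔
        ∃ n : ℕ, 2 * s ∣ Nat.fib (2 * n + 1)) := fun hs hk ↦ by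
    simp only [← lucasSeq_one]
    exact exists_neg_pell_iff_dvd_lucasSeq one_pos (by positivity) (by rw [hk]; push_cast; ring)
  have htwo : ∀ {s : ℕ}, 0 < s → k = 2 * (s : ℤ) ^ 2 →
      ((∃ p q : ℤ, 0 < p ∧ 0 < q ∧ p ^ 2 - k * q ^ 2 = -1) ↔
        ∃ n : ℕ, s ∣ pellNumber (2 * n + 1)) := fun hs hk ↦ by
    simp only [← lucasSeq_two]
    exact exists_neg_pell_iff_dvd_lucasSeq two_pos hs (by rw [hk]; push_cast; ring)
  constructor
  · rintro ⟨s, hs, ⟨hk, hd, hn⟩ | ⟨hk, hd, hn⟩⟩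
    · exact ⟨⟨s, mod_cast hs, Or.inl ⟨hk, hd⟩⟩, (hfive hs hk).2 hn⟩
    · exact ⟨⟨s, mod_cast hs, Or.inr ⟨hk, hd⟩⟩, (htwo hs hk).2 hn⟩
  · rintro ⟨⟨s, hs, h⟩, hpell⟩
    lift s to ℕ using hs.le
    have hs : 0 < s := mod_cast hs
    rcases h with ⟨hk, hd⟩ | ⟨hk, hd⟩
    · exact ⟨s, hs, Or.inl ⟨hk, hd, (hfive hs hk).1 hpell⟩⟩
    · exact ⟨s, hs, Or.inr ⟨hk, hd, (htwo hs hk).1 hpell⟩⟩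

theorem IsExceptionalShape.lt_sq {k d : ℤ} (h : IsExceptionalShape k d) : k < d ^ 2 := by
  obtain ⟨s, hs, ⟨rfl, rfl | rfl⟩ | ⟨rfl, rfl⟩⟩ := h <;> nlinarith

theorem sub_sq_dvd_of_div_eq {k d R : ℤ} (hne : k ≠ d ^ 2)
    (h : (4 * (d : ℚ) ^ 2) / ((k : ℚ) - (d : ℚ) ^ 2) = (R : ℚ)) : k - d ^ 2 ∣ 4 * d ^ 2 := by
  have hne' : (k : ℚ) - (d : ℚ) ^ 2 ≠ 0 := sub_ne_zero.2 (mod_cast hne)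
  rw [div_eq_iff hne'] at h
  exact ⟨R, by rw [mul_comm _ R]; exact_mod_cast h⟩

theorem corollary6p6 (k d : ℤ) (hk : 0 < k) (hsq : ¬ IsSquare k) (hd : 0 < d)
    (hR : ∃ R : ℤ, (4 * (d : ℚ) ^ 2) / ((k : ℚ) - (d : ℚ) ^ 2) = (R : ℚ)) :
    ((∀ p q : ℤ, IsPellianConvergent k p q →
        (((p : ℝ) / (q : ℝ) : ℝ) : OnePoint ℝ) ∈ orbitInfty (k : ℝ) (d : ℝ)) ↔
      ¬ IsExceptionalPair k d) ∧
    (∀ p q : ℤ, IsSqrtConvergent k p q → p ^ 2 - k * q ^ 2 = 1 →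
        (((p : ℝ) / (q : ℝ) : ℝ) : OnePoint ℝ) ∈ orbitInfty (k : ℝ) (d : ℝ)) := by
  have hne : k ≠ d ^ 2 := fun h ↦ hsq ⟨d, h.trans (sq d)⟩
  obtain ⟨R, hR⟩ := hR
  have hdvd := sub_sq_dvd_of_div_eq hne hR
  refine ⟨⟨fun hall hexc ↦ ?_, fun hexc p q ⟨⟨hp, hq, _⟩, hpq⟩ ↦ ?_⟩,
    fun p q ⟨hp, hq, _⟩ hpq ↦ ?_⟩
  · obtain ⟨hshape, p, q, hp, hq, hpq⟩ := isExceptionalPair_iff.1 hexc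
    have hmem := hall p q ⟨isSqrtConvergent_of_neg_pell hp hq hpq, Or.inr hpq⟩
    have hlt : √(k : ℝ) < p / q :=
      sqrt_lt_of_mem_orbitInfty (mod_cast hk) (mod_cast hd) (mod_cast hshape.lt_sq) hmem
    exact hlt.not_gt (div_lt_sqrt_of_neg_pell hp hq hpq)
  · refine (div_mem_orbitInfty_or_isExceptionalShape hk hd hne hdvd (sq_eq_one_iff.2 hpq) hp hq
      rfl).resolve_right fun ⟨hneg, hshape⟩ ↦ ?_
    exact hexc (isExceptionalPair_iff.2 ⟨hshape, p, q, hp, hq, hneg⟩)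
  · exact (div_mem_orbitInfty_or_isExceptionalShape hk hd hne hdvd (one_pow 2) hp hq
      hpq).resolve_right fun ⟨hneg, _⟩ ↦ absurd hneg (by norm_num)
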